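/- Let $h\ge 1$ be a fixed integer. For real $R\ge 1$ let $G_R$ be the graph with vertex set $\mathbb{Z}^2$ in which two distinct nodes are adjacent if and only if their Euclidean distance is at most $R$. A colouring $c:\mathbb{Z}^2\to\mathbb{N}$ is a valid $h$-hop colouring if $c(u)\ne c(v)$ whenever the graph distance of $u$ and $v$ in $G_R$ is $k$ for some $1\le k\le h$. It is periodic if there are two linearly independent vectors $v,w\in\mathbb{Z}^2$ with $c(u+v)=c(u)=c(u+w)$ for all $u$; it is generated by the two vectors $v,w$ if moreover each colour is reproduced nowhere else, i.e. $c(u')=c(u)$ if and only if $u'-u\in\mathbb{Z}v+\mathbb{Z}w$. Let $n_c(R)$ be the least number of colours used by a valid periodic $h$-hop colouring of $G_R$. This minimum exists for every $R\ge 1$, and $$n_c(R)=\frac{\sqrt3}{2}\,h^2R^2\left(1+O\!\left(\frac1R\right)\right)\qquad (R\to\infty),$$ where the implied constant may depend on $h$. The same holds if $n_c(R)$ is instead the least number of colours of a valid $h$-hop colouring of $G_R$ generated by two linearly independent vectors. -/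

import Mathlib

open Filter Asymptotics

/-- Euclidean distance between two nodes of the infinite unit grid. -/
noncomputable def gridDist (u v : ℤ × ℤ) : ℝ :=
  Real.sqrt (((u.1 - v.1 : ℤ) : ℝ) ^ 2 + ((u.2 - v.2 : ℤ) : ℝ) ^ 2)

/-- The network on the infinite grid with transmission range `R`: two distinct nodes are
one-hop neighbours when their Euclidean distance is at most `R`. -/
def gridGraph (R : ℝ) : SimpleGraph (ℤ × ℤ) where
  Adj u v := u ≠ v ∧ gridDist u v ≤ R
  symm := ⟨fun u v huv => ⟨huv.1.symm, by
    have h : gridDist v u = gridDist u v := by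
      unfold gridDist
      congr 1
      push_cast
      ring
    exact h ▸ huv.2⟩⟩
  loopless := ⟨fun _ hu => hu.1 rfl⟩

/-- `v` is a `k`-hop neighbour of `u` (`k ≥ 1`): a shortest path from `u` to `v` has `k` edges.
(The distance is `0` by convention between nodes that no path connects, so these are not
`k`-hop neighbours for any `k ≥ 1`.) -/
def IsHopNeighbour {V : Type*} (G : SimpleGraph V) (k : ℕ) (u v : V) : Prop :=
  1 ≤ k ∧ G.dist u v = k

/-- Validity of an `h`-hop node colouring (colours are natural numbers). -/
def IsValidHopColouring {V : Type*} (G : SimpleGraph V) (h : ℕ) (c : V → ℕ) : Prop :=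
  ∀ u v : V, ∀ k : ℕ, k ≤ h → IsHopNeighbour G k u v → c u ≠ c v

/-- Linear independence of two integer vectors, through their determinant. -/
def AreIndependent (v w : ℤ × ℤ) : Prop := v.1 * w.2 - w.1 * v.2 ≠ 0

/-- A colouring of the grid that periodically reproduces a colour pattern: it has two
linearly independent periods. -/
def IsPeriodicColouring (c : ℤ × ℤ → ℕ) : Prop :=
  ∃ v w : ℤ × ℤ, AreIndependent v w ∧ Function.Periodic c v ∧ Function.Periodic c w

/-- A periodic colouring generated by two vectors: the colour of a node `u` is reproduced exactly
at the nodes `u + a v + b w`, with `a` and `b` integers. -/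
def IsVectorColouring (c : ℤ × ℤ → ℕ) : Prop :=
  ∃ v w : ℤ × ℤ, AreIndependent v w ∧
    ∀ u u' : ℤ × ℤ, c u' = c u ↔ ∃ a b : ℤ, u' = u + a • v + b • w

/-- The numbers of colours used by the valid `h`-hop colourings of the grid, with transmission
range `R`, that belong to the class `P`. -/
def colourCounts (P : (ℤ × ℤ → ℕ) → Prop) (h : ℕ) (R : ℝ) : Set ℕ :=
  {n | ∃ c : ℤ × ℤ → ℕ, P c ∧ IsValidHopColouring (gridGraph R) h c ∧
    (Set.range c).encard = (n : ℕ∞)}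

/-- The number of colours of an optimal `h`-hop colouring in the class `P`. -/
noncomputable def optimalColours (P : (ℤ × ℤ → ℕ) → Prop) (h : ℕ) (R : ℝ) : ℕ :=
  sInf (colourCounts P h R)

/-! Up to `O(R)`, a valid colouring is one whose colour classes have minimum distance `h * R`, so
the count is governed by the densest planar packing.

Lower bound: rounding equally spaced points of a segment to the grid shows that nodes at distance at
most `h * (R - 2)` are within `h` hops, so each class is separated by that distance `d`. Thue's
bound (`card_mul_le_of_separated`) gives each point of a class area at least `√3 / 2 * d ^ 2`.
Counting nodes of a growing square by colour gives `√3 / 2 * (h * (R - 2)) ^ 2` colours or more, for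
any valid colouring with finitely many colours.

Thue's bound is local. With `ρ = d / √3`, cut each Voronoi cell to the disc of radius `ρ` about its
point. Each other point removes at most a circular segment; the sectors over these segments are
disjoint, and concavity of sine shows that each keeps at least the fraction `3√3 / (2π)` of its
area, the ratio of an inscribed regular hexagon to its disc.

Upper bound: `latticeColouring` uses the cosets of a nearly hexagonal lattice of minimum length
above `h * R` and determinant `√3 / 2 * h ^ 2 * R ^ 2 + O(R)`. -/

open MeasureTheory

/-! ### Areas and disjointness of sectors -/

/-- The open sector of radius `ρ` around the direction of `v` whose two bounding radii end on the
perpendicular bisector of `0` and `v`. -/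
def capSector (ρ : ℝ) (v : ℂ) : Set ℂ :=
  {z | ‖z‖ < ρ ∧ ‖z‖ * ‖v‖ ^ 2 < 2 * ρ * (z.re * v.re + z.im * v.im)}

/-- The part of `capSector ρ v` that is closer to `0` than to `v`. -/
def capTriangle (ρ : ℝ) (v : ℂ) : Set ℂ :=
  capSector ρ v ∩ {z | 2 * (z.re * v.re + z.im * v.im) < ‖v‖ ^ 2}

theorem isOpen_capSector (ρ : ℝ) (v : ℂ) : IsOpen (capSector ρ v) := by
  refine IsOpen.and (isOpen_lt ?_ ?_) (isOpen_lt ?_ ?_) <;> fun_prop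

theorem isOpen_capTriangle (ρ : ℝ) (v : ℂ) : IsOpen (capTriangle ρ v) :=
  (isOpen_capSector ρ v).inter (isOpen_lt (by fun_prop) (by fun_prop))

theorem volume_sector_le {ρ α : ℝ} (hρ : 0 < ρ) (hα : 0 ≤ α) :
    volume {z : ℂ | ‖z‖ < ρ ∧ ‖z‖ * Real.cos α < z.re} ≤ ENNReal.ofReal (α * ρ ^ 2) := by
  set S := {z : ℂ | ‖z‖ < ρ ∧ ‖z‖ * Real.cos α < z.re} with hS
  have hSm : MeasurableSet S := by
    refine (IsOpen.and (isOpen_lt ?_ ?_) (isOpen_lt ?_ ?_)).measurableSet <;> fun_prop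
  rw [← lintegral_indicator_one hSm, ← Complex.lintegral_comp_polarCoord_symm]
  have hle : ∀ p ∈ polarCoord.target,
      ENNReal.ofReal p.1 • S.indicator 1 (Complex.polarCoord.symm p) ≤
        (Set.Ioo 0 ρ ×ˢ Set.Ioo (-α) α).indicator (fun p => ENNReal.ofReal p.1) p := by
    rintro ⟨r, θ⟩ ⟨hr, hθ⟩
    simp only [Set.mem_Ioi, Set.mem_Ioo] at hr hθ
    by_cases hp : Complex.polarCoord.symm (r, θ) ∈ S
    · have h1 := hp.1
      have h2 := hp.2
      rw [Complex.norm_polarCoord_symm, abs_of_pos hr] at h1 h2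
      have h3 : (Complex.polarCoord.symm (r, θ)).re = r * Real.cos θ := by
        simp [Complex.polarCoord_symm_apply, -Complex.ofReal_cos, -Complex.ofReal_sin]
      rw [h3] at h2
      have h4 : Real.cos α < Real.cos θ := lt_of_mul_lt_mul_left h2 hr.le
      have h5 : |θ| < α := by
        by_contra! hc
        have := Real.cos_le_cos_of_nonneg_of_le_pi hα (abs_le.2 ⟨hθ.1.le, hθ.2.le⟩) hc
        rw [Real.cos_abs] at this
        linarith
      have h6 : (r, θ) ∈ Set.Ioo 0 ρ ×ˢ Set.Ioo (-α) α := ⟨⟨hr, h1⟩, abs_lt.1 h5⟩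
      rw [Set.indicator_of_mem hp, Set.indicator_of_mem h6]
      simp
    · rw [Set.indicator_of_notMem hp]
      simp
  refine (setLIntegral_mono' polarCoord.open_target.measurableSet hle).trans ?_
  refine (setLIntegral_le_lintegral _ _).trans ?_
  rw [lintegral_indicator (measurableSet_Ioo.prod measurableSet_Ioo), Measure.volume_eq_prod,
    ← Measure.prod_restrict, lintegral_prod _ (by fun_prop)]
  simp only [lintegral_const, Measure.restrict_apply_univ, Real.volume_Ioo]
  rw [lintegral_mul_const _ (by fun_prop)]
  have : ∫⁻ x in Set.Ioo 0 ρ, ENNReal.ofReal x = ENNReal.ofReal (ρ ^ 2 / 2) := by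
    rw [← ofReal_integral_eq_lintegral_ofReal, ← integral_Ioc_eq_integral_Ioo,
      ← intervalIntegral.integral_of_le hρ.le, integral_id]
    · simp
    · exact (continuous_id.integrableOn_Icc (a := 0) (b := ρ)).mono_set Set.Ioo_subset_Icc_self
    · filter_upwards [ae_restrict_mem measurableSet_Ioo] with x hx using hx.1.le
  rw [this, ← ENNReal.ofReal_mul (by positivity)]
  exact ENNReal.ofReal_le_ofReal (by nlinarith)

/-- The triangle contains the region between the lines of slope `± tan α` over `(0, ρ cos α)`, whose
area is elementary. -/
theorem le_volume_triangle {ρ α : ℝ} (hρ : 0 < ρ) (hα : 0 ≤ α) (hα' : α < Real.pi / 2) :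
    ENNReal.ofReal (ρ ^ 2 * (Real.sin α * Real.cos α)) ≤
      volume {z : ℂ | (‖z‖ < ρ ∧ ‖z‖ * Real.cos α < z.re) ∧ z.re < ρ * Real.cos α} := by
  have hc : 0 < Real.cos α := Real.cos_pos_of_mem_Ioo ⟨by linarith [Real.pi_pos], hα'⟩
  have hs : 0 ≤ Real.sin α := Real.sin_nonneg_of_nonneg_of_le_pi hα (by linarith [Real.pi_pos])
  set t := Real.tan α with ht
  have htc : t * Real.cos α = Real.sin α := Real.tan_mul_cos hc.ne'
  have ht0 : 0 ≤ t := by rw [ht, Real.tan_eq_sin_div_cos]; positivity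
  set B := regionBetween (fun x => -(t * x)) (fun x => t * x) (Set.Ioo 0 (ρ * Real.cos α))
  have hB : volume B = ENNReal.ofReal (ρ ^ 2 * (Real.sin α * Real.cos α)) := by
    rw [Measure.volume_eq_prod, volume_regionBetween_eq_integral]
    · congr 1
      rw [← integral_Ioc_eq_integral_Ioo,
        ← intervalIntegral.integral_of_le (by positivity)]
      have : ∀ x : ℝ, ((fun x => t * x) - fun x => -(t * x)) x = (2 * t) * x := fun x => by
        simp only [Pi.sub_apply]; ring
      simp only [this]
      rw [intervalIntegral.integral_const_mul, integral_id, ← htc]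
      ring
    · exact (Continuous.integrableOn_Icc (by fun_prop)).mono_set Set.Ioo_subset_Icc_self
    · exact (Continuous.integrableOn_Icc (by fun_prop)).mono_set Set.Ioo_subset_Icc_self
    · exact measurableSet_Ioo
    · intro x hx
      have := mul_nonneg ht0 hx.1.le
      linarith
  have hBm : MeasurableSet B :=
    measurableSet_regionBetween (by fun_prop) (by fun_prop) measurableSet_Ioo
  rw [← hB, ← Complex.volume_preserving_equiv_real_prod.measure_preimage hBm.nullMeasurableSet]
  refine measure_mono ?_
  rintro z ⟨⟨hz0, hz1⟩, hz2⟩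
  simp only [Complex.measurableEquivRealProd_apply, Set.mem_Ioo] at hz0 hz1 hz2
  have h1 : ‖z‖ * Real.cos α < z.re := by
    refine lt_of_pow_lt_pow_left₀ 2 hz0.le ?_
    have h2 : z.im ^ 2 < (t * z.re) ^ 2 := sq_lt_sq' (by linarith) hz2.2
    have h3 : ‖z‖ ^ 2 = z.re ^ 2 + z.im ^ 2 := by
      rw [Complex.sq_norm, Complex.normSq_apply]; ring
    have h4 := Real.sin_sq_add_cos_sq α
    have h5 : z.im ^ 2 * Real.cos α ^ 2 < (t * z.re) ^ 2 * Real.cos α ^ 2 := by gcongr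
    have h6 : (t * z.re) ^ 2 * Real.cos α ^ 2 = Real.sin α ^ 2 * z.re ^ 2 := by
      rw [← htc]; ring
    rw [mul_pow, h3]
    nlinarith
  refine ⟨⟨lt_of_mul_lt_mul_right (h1.trans hz1) hc.le, h1⟩, hz1⟩

/-- On `[0, π/3]` the concave function sine lies above its chord; evaluate at `2 * α`. Equality at
`α = π/6` is the regular hexagon. -/
theorem three_sqrt_three_mul_le_sin_two_mul {α : ℝ} (hα : 0 ≤ α) (hα' : α ≤ Real.pi / 6) :
    3 * √3 / (2 * Real.pi) * α ≤ Real.sin α * Real.cos α := by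
  have hpi := Real.pi_pos
  have h := strictConcaveOn_sin_Icc.concaveOn.2
    (Set.left_mem_Icc.2 hpi.le) (⟨by positivity, by linarith⟩ : Real.pi / 3 ∈ Set.Icc 0 Real.pi)
    (show 0 ≤ 1 - 6 * α / Real.pi by rw [sub_nonneg, div_le_one hpi]; linarith) (show 0 ≤ 6 * α / Real.pi by positivity) (by ring)
  simp only [smul_eq_mul, mul_zero, Real.sin_zero, zero_add, Real.sin_pi_div_three] at h
  have h1 : 6 * α / Real.pi * (Real.pi / 3) = 2 * α := by field_simp; ring
  rw [h1, Real.sin_two_mul] at h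
  have h2 : 6 * α / Real.pi * (√3 / 2) = 2 * (3 * √3 / (2 * Real.pi) * α) := by field_simp; ring
  linarith

theorem volume_capSector_real_le {ρ s : ℝ} (hρ : 0 < ρ) (hs : √3 * ρ ≤ s) :
    ENNReal.ofReal (3 * √3 / (2 * Real.pi)) * volume (capSector ρ (s : ℂ)) ≤
      volume (capTriangle ρ (s : ℂ)) := by
  have h3 : 0 < √3 := by positivity
  have hs0 : 0 < s := by nlinarith [mul_pos h3 hρ]
  by_cases hsr : 2 * ρ ≤ s
  -- Here the perpendicular bisector misses the open disc.
  · have : capSector ρ (s : ℂ) = ∅ := by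
      ext z
      simp only [capSector, Set.mem_ofPred_eq, Set.mem_empty_iff_false, iff_false, not_and, not_lt,
        Complex.ofReal_re, Complex.ofReal_im, mul_zero, add_zero, Complex.norm_real,
        Real.norm_eq_abs, sq_abs]
      intro _
      have h1 := Complex.re_le_norm z
      have h2 := norm_nonneg z
      calc 2 * ρ * (z.re * s) ≤ 2 * ρ * (‖z‖ * s) := by gcongr
        _ ≤ s * (‖z‖ * s) := by gcongr
        _ = _ := by ring
    simp [this]
  push Not at hsr
  -- Half the opening angle: the bisector lies at distance `s / 2` from the centre. It is at most
  -- `π/6` because `s ≥ √3 * ρ`.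
  set α := Real.arccos (s / (2 * ρ)) with hαd
  have hcos : Real.cos α = s / (2 * ρ) :=
    Real.cos_arccos (by have : 0 < s / (2 * ρ) := by positivity
                        linarith) (by rw [div_le_one (by positivity)]; exact hsr.le)
  have hα0 : 0 ≤ α := Real.arccos_nonneg _
  have hα6 : α ≤ Real.pi / 6 := by
    have : Real.arccos (√3 / 2) = Real.pi / 6 := by
      rw [← Real.cos_pi_div_six]
      exact Real.arccos_cos (by positivity) (by linarith [Real.pi_pos])
    rw [← this]
    refine Real.arccos_le_arccos ?_
    rw [div_le_div_iff₀ (by norm_num) (by positivity)]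
    linarith
  have hsec : capSector ρ (s : ℂ) = {z : ℂ | ‖z‖ < ρ ∧ ‖z‖ * Real.cos α < z.re} := by
    ext z
    simp only [capSector, Set.mem_ofPred_eq, Complex.ofReal_re, Complex.ofReal_im, mul_zero,
      add_zero, Complex.norm_real, Real.norm_eq_abs, sq_abs, hcos]
    refine and_congr_right fun _ => ?_
    rw [← mul_div_assoc, div_lt_iff₀ (by positivity),
      ← mul_lt_mul_iff_left₀ hs0 (b := ‖z‖ * s)]
    exact iff_of_eq (by congr 1 <;> ring)
  have htri : capTriangle ρ (s : ℂ) =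
      {z : ℂ | (‖z‖ < ρ ∧ ‖z‖ * Real.cos α < z.re) ∧ z.re < ρ * Real.cos α} := by
    rw [capTriangle, hsec]
    ext z
    simp only [Set.mem_inter_iff, Set.mem_ofPred_eq, Complex.ofReal_re, Complex.ofReal_im, mul_zero,
      add_zero, Complex.norm_real, Real.norm_eq_abs, sq_abs, hcos]
    refine and_congr_right fun _ => ?_
    rw [show ρ * (s / (2 * ρ)) = s / 2 by field_simp, lt_div_iff₀ (by norm_num),
      ← mul_lt_mul_iff_left₀ hs0 (b := z.re * 2)]
    exact iff_of_eq (by congr 1 <;> ring)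
  rw [hsec, htri]
  refine le_trans ?_ (le_volume_triangle hρ hα0 (by linarith [Real.pi_pos]))
  calc _ ≤ ENNReal.ofReal (3 * √3 / (2 * Real.pi)) * ENNReal.ofReal (α * ρ ^ 2) := by
        gcongr; exact volume_sector_le hρ hα0
    _ = ENNReal.ofReal (3 * √3 / (2 * Real.pi) * (α * ρ ^ 2)) :=
        (ENNReal.ofReal_mul (by positivity)).symm
    _ ≤ _ := by
      refine ENNReal.ofReal_le_ofReal ?_
      have := mul_le_mul_of_nonneg_left (three_sqrt_three_mul_le_sin_two_mul hα0 hα6) (sq_nonneg ρ)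
      linarith

/-- Both sets turn with `v`, so a rotation reduces to `v` on the positive real axis. -/
theorem volume_capSector_le {ρ : ℝ} {v : ℂ} (hρ : 0 < ρ) (hv : √3 * ρ ≤ ‖v‖) :
    ENNReal.ofReal (3 * √3 / (2 * Real.pi)) * volume (capSector ρ v) ≤
      volume (capTriangle ρ v) := by
  have hv0 : 0 < ‖v‖ := lt_of_lt_of_le (by positivity) hv
  obtain ⟨u, hu⟩ : ∃ u : Circle, v = u * (‖v‖ : ℂ) := by
    refine ⟨Circle.exp v.arg, ?_⟩
    rw [Circle.coe_exp, mul_comm, Complex.norm_mul_exp_arg_mul_I]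
  have hmp := (rotation u).measurePreserving
  have hin : ∀ z : ℂ, (rotation u z).re * v.re + (rotation u z).im * v.im =
      z.re * (‖v‖ : ℂ).re + z.im * (‖v‖ : ℂ).im := by
    intro z
    have h1 : (u : ℂ).re * (u : ℂ).re + (u : ℂ).im * (u : ℂ).im = 1 := by
      rw [← Complex.normSq_apply]; simp
    conv_lhs => rw [hu]
    simp only [rotation_apply, Complex.mul_re, Complex.mul_im, Complex.ofReal_re,
      Complex.ofReal_im, mul_zero, sub_zero, zero_add, add_zero]
    linear_combination (z.re * ‖v‖) * h1
  have hnorm : ∀ z : ℂ, ‖rotation u z‖ = ‖z‖ := (rotation u).norm_map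
  have h1 : rotation u ⁻¹' capSector ρ v = capSector ρ (‖v‖ : ℂ) := by
    ext z
    simp only [capSector, Set.mem_preimage, Set.mem_ofPred_eq, hin, hnorm]
    simp
  have h2 : rotation u ⁻¹' capTriangle ρ v = capTriangle ρ (‖v‖ : ℂ) := by
    rw [capTriangle, Set.preimage_inter, h1, capTriangle]
    ext z
    simp only [Set.mem_inter_iff, Set.mem_preimage, Set.mem_ofPred_eq, hin]
    simp
  rw [← hmp.measure_preimage (isOpen_capSector ρ v).measurableSet.nullMeasurableSet,
    ← hmp.measure_preimage (isOpen_capTriangle ρ v).measurableSet.nullMeasurableSet, h1, h2]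
  exact volume_capSector_real_le hρ hv

theorem Complex.sq_norm_eq_re_im (z : ℂ) : ‖z‖ ^ 2 = z.re ^ 2 + z.im ^ 2 := by
  rw [Complex.sq_norm, Complex.normSq_apply]; ring

/-- If `y` lies in both sectors and `e` is its direction, then `v` and `w` lie in the open disc of
radius `ρ` about `ρ * e`, whose boundary contains `0`. Three points in a disc of radius `ρ` have
squared mutual distances summing to at most `9 * ρ ^ 2`, here strictly less, whereas separation
forces at least `9 * ρ ^ 2`. -/
theorem disjoint_capSector {ρ : ℝ} {v w : ℂ} (hρ : 0 < ρ) (hv : √3 * ρ ≤ ‖v‖)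
    (hw : √3 * ρ ≤ ‖w‖) (hvw : √3 * ρ ≤ ‖v - w‖) :
    Disjoint (capSector ρ v) (capSector ρ w) := by
  have hsq : ∀ u : ℂ, √3 * ρ ≤ ‖u‖ → 3 * ρ ^ 2 ≤ u.re ^ 2 + u.im ^ 2 := by
    intro u hu
    rw [← Complex.sq_norm_eq_re_im]
    calc 3 * ρ ^ 2 = (√3 * ρ) ^ 2 := by rw [mul_pow, Real.sq_sqrt (by norm_num)]
      _ ≤ ‖u‖ ^ 2 := by gcongr
  rw [Set.disjoint_left]
  rintro y ⟨-, hyv⟩ ⟨-, hyw⟩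
  rcases (norm_nonneg y).eq_or_lt with h0 | h0
  · rw [eq_comm, norm_eq_zero] at h0
    simp [h0] at hyv
  obtain ⟨a, b, ha, hb⟩ : ∃ a b : ℝ, y.re = ‖y‖ * a ∧ y.im = ‖y‖ * b :=
    ⟨y.re / ‖y‖, y.im / ‖y‖, by field_simp, by field_simp⟩
  have hab : a ^ 2 + b ^ 2 = 1 := by
    have h := Complex.sq_norm_eq_re_im y
    rw [ha, hb] at h
    have : ‖y‖ ^ 2 ≠ 0 := by positivity
    apply mul_left_cancel₀ this
    linarith
  have key : ∀ u : ℂ, ‖y‖ * ‖u‖ ^ 2 < 2 * ρ * (y.re * u.re + y.im * u.im) →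
      (u.re - ρ * a) ^ 2 + (u.im - ρ * b) ^ 2 < ρ ^ 2 := by
    intro u hu
    rw [ha, hb, Complex.sq_norm_eq_re_im] at hu
    have : u.re ^ 2 + u.im ^ 2 < 2 * ρ * (a * u.re + b * u.im) :=
      lt_of_mul_lt_mul_left (by linarith) h0.le
    linear_combination this + ρ ^ 2 * hab
  have h1 := key v hyv
  have h2 := key w hyw
  have h3 := hsq v hv
  have h4 := hsq w hw
  have h5 := hsq _ hvw
  simp only [Complex.sub_re, Complex.sub_im] at h5
  have h6 : (ρ * a) ^ 2 + (ρ * b) ^ 2 = ρ ^ 2 := by linear_combination ρ ^ 2 * hab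
  linarith [sq_nonneg (v.re + w.re - 3 * (ρ * a)), sq_nonneg (v.im + w.im - 3 * (ρ * b))]

/-! ### Truncated Voronoi cells and Thue's bound -/

/-- The Voronoi cell of `p` with respect to the finite set `A`, truncated to the disc of
radius `ρ` around `p`. -/
def truncatedCell (ρ : ℝ) (A : Finset ℂ) (p : ℂ) : Set ℂ :=
  {x | ‖x - p‖ < ρ ∧ ∀ q ∈ A, q ≠ p → ‖x - p‖ < ‖x - q‖}

theorem isOpen_truncatedCell (ρ : ℝ) (A : Finset ℂ) (p : ℂ) : IsOpen (truncatedCell ρ A p) := by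
  have : truncatedCell ρ A p =
      {x | ‖x - p‖ < ρ} ∩ ⋂ q ∈ A.erase p, {x | ‖x - p‖ < ‖x - q‖} := by
    ext x
    simp only [truncatedCell, Finset.mem_erase, Set.mem_inter_iff, Set.mem_iInter,
      Set.mem_ofPred_eq]
    exact and_congr_right fun _ => ⟨fun h q hq => h q hq.2 hq.1, fun h q hq hp => h q ⟨hp, hq⟩⟩
  rw [this]
  refine IsOpen.inter (isOpen_lt ?_ ?_)
    (isOpen_biInter_finset fun q _ => isOpen_lt ?_ ?_) <;> fun_prop

theorem disjoint_truncatedCell (ρ : ℝ) {A : Finset ℂ} {p q : ℂ} (hp : p ∈ A) (hq : q ∈ A)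
    (hpq : p ≠ q) : Disjoint (truncatedCell ρ A p) (truncatedCell ρ A q) := by
  rw [Set.disjoint_left]
  rintro x hx hx'
  exact lt_asymm (hx.2 q hq hpq.symm) (hx'.2 p hp hpq)

theorem norm_lt_norm_sub_iff (y v : ℂ) :
    ‖y‖ < ‖y - v‖ ↔ 2 * (y.re * v.re + y.im * v.im) < ‖v‖ ^ 2 := by
  rw [← sq_lt_sq₀ (norm_nonneg _) (norm_nonneg _)]
  simp only [Complex.sq_norm_eq_re_im, Complex.sub_re, Complex.sub_im]
  constructor <;> intro h <;> linarith

/-- The cell about `p` contains the disc outside all sectors, and the triangle inside each sector.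
Each triangle has at least the fraction `c ≤ 1` of its sector, so the cell has at least that
fraction of the disc. -/
theorem le_volume_truncatedCell {ρ : ℝ} (hρ : 0 < ρ) {A : Finset ℂ}
    (hA : ∀ p ∈ A, ∀ q ∈ A, p ≠ q → √3 * ρ ≤ ‖p - q‖) {p : ℂ} (hp : p ∈ A) :
    ENNReal.ofReal (3 * √3 / 2 * ρ ^ 2) ≤ volume (truncatedCell ρ A p) := by
  set c := ENNReal.ofReal (3 * √3 / (2 * Real.pi)) with hc
  set U := ⋃ q ∈ A.erase p, capSector ρ (q - p) with hU
  set T := ⋃ q ∈ A.erase p, capTriangle ρ (q - p) with hT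
  set D := Metric.ball (0 : ℂ) ρ
  have hmem : ∀ q ∈ A.erase p, √3 * ρ ≤ ‖q - p‖ := fun q hq =>
    hA q (Finset.mem_of_mem_erase hq) p hp (Finset.ne_of_mem_erase hq)
  have hdisj : ∀ q ∈ A.erase p, ∀ r ∈ A.erase p, q ≠ r →
      Disjoint (capSector ρ (q - p)) (capSector ρ (r - p)) := fun q hq r hr hqr =>
    disjoint_capSector hρ (hmem q hq) (hmem r hr) (by
      rw [sub_sub_sub_cancel_right]
      exact hA q (Finset.mem_of_mem_erase hq) r (Finset.mem_of_mem_erase hr) hqr)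
  have hTU : T ⊆ U := Set.iUnion₂_mono fun q _ => Set.inter_subset_left
  have hTm : MeasurableSet T :=
    (isOpen_biUnion fun q _ => isOpen_capTriangle ρ (q - p)).measurableSet
  have hT_vol : c * volume U ≤ volume T := by
    have hTd : (A.erase p : Set ℂ).PairwiseDisjoint fun q => capTriangle ρ (q - p) :=
      fun q hq r hr hqr =>
        (hdisj q hq r hr hqr).mono Set.inter_subset_left Set.inter_subset_left
    rw [hT, measure_biUnion_finset hTd
      (fun q _ => (isOpen_capTriangle ρ (q - p)).measurableSet)]
    calc c * volume U ≤ c * ∑ q ∈ A.erase p, volume (capSector ρ (q - p)) := by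
          gcongr; exact measure_biUnion_finset_le _ _
      _ = ∑ q ∈ A.erase p, c * volume (capSector ρ (q - p)) := Finset.mul_sum _ _ _
      _ ≤ _ := Finset.sum_le_sum fun q hq => volume_capSector_le hρ (hmem q hq)
  have hc1 : c ≤ 1 := by
    rw [hc, ENNReal.ofReal_le_one, div_le_one (by positivity)]
    have h1 : √3 ≤ 1.74 := Real.sqrt_le_iff.2 ⟨by norm_num, by norm_num⟩
    linarith [Real.pi_gt_three, Real.pi_gt_d2]
  have hsub : (D \ U) ∪ T ⊆ (fun y => y + p) ⁻¹' truncatedCell ρ A p := by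
    rintro y (⟨hyD, hyU⟩ | hyT)
    · have hy : ‖y‖ < ρ := mem_ball_zero_iff.1 hyD
      refine ⟨by simpa using hy, fun q hq hqp => ?_⟩
      have hq' : q ∈ A.erase p := Finset.mem_erase.2 ⟨hqp, hq⟩
      have h1 : y ∉ capSector ρ (q - p) := fun h => hyU (Set.mem_biUnion hq' h)
      rw [add_sub_cancel_right, show y + p - q = y - (q - p) by ring, norm_lt_norm_sub_iff]
      by_contra! h2
      refine h1 ⟨hy, ?_⟩
      have h3 : 0 < ‖q - p‖ := norm_pos_iff.2 (sub_ne_zero.2 hqp)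
      calc ‖y‖ * ‖q - p‖ ^ 2 < ρ * ‖q - p‖ ^ 2 := by gcongr
        _ ≤ ρ * (2 * (y.re * (q - p).re + y.im * (q - p).im)) := by gcongr
        _ = _ := by ring
    · obtain ⟨r, hr, hyr⟩ := Set.mem_iUnion₂.1 hyT
      have hy : ‖y‖ < ρ := hyr.1.1
      refine ⟨by simpa using hy, fun q hq hqp => ?_⟩
      have hq' : q ∈ A.erase p := Finset.mem_erase.2 ⟨hqp, hq⟩
      rw [add_sub_cancel_right, show y + p - q = y - (q - p) by ring, norm_lt_norm_sub_iff]
      by_cases hqr : q = r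
      · rw [hqr]; exact hyr.2
      by_contra! h2
      refine Set.disjoint_left.1 (hdisj q hq' r hr hqr) ⟨hy, ?_⟩ hyr.1
      have h3 : 0 < ‖q - p‖ := norm_pos_iff.2 (sub_ne_zero.2 hqp)
      calc ‖y‖ * ‖q - p‖ ^ 2 < ρ * ‖q - p‖ ^ 2 := by gcongr
        _ ≤ ρ * (2 * (y.re * (q - p).re + y.im * (q - p).im)) := by gcongr
        _ = _ := by ring
  have hD : ENNReal.ofReal (3 * √3 / 2 * ρ ^ 2) = c * volume D := by
    have : (NNReal.pi : ENNReal) = ENNReal.ofReal Real.pi := by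
      rw [← NNReal.coe_real_pi, ENNReal.ofReal_coe_nnreal]
    rw [Complex.volume_ball, this, ← ENNReal.ofReal_pow hρ.le,
      ← ENNReal.ofReal_mul (by positivity), ← ENNReal.ofReal_mul (by positivity)]
    congr 1
    field_simp
  calc _ = c * volume D := hD
    _ ≤ c * (volume (D \ U) + volume U) := by
        gcongr
        refine (measure_mono (fun x hx => ?_)).trans (measure_union_le (D \ U) U)
        by_cases h : x ∈ U
        · exact Or.inr h
        · exact Or.inl ⟨hx, h⟩
    _ = c * volume (D \ U) + c * volume U := mul_add _ _ _
    _ ≤ 1 * volume (D \ U) + volume T := by gcongr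
    _ = volume ((D \ U) ∪ T) := by
        rw [one_mul, measure_union (Set.disjoint_left.2 fun x hx hx' => hx.2 (hTU hx')) hTm]
    _ ≤ volume ((fun y => y + p) ⁻¹' truncatedCell ρ A p) := measure_mono hsub
    _ = _ := measure_preimage_add_right _ _ _

/-- Thue's bound for a finite separated set in a square. -/
theorem card_mul_le_of_separated {d L : ℝ} (hd : 0 < d) (hL : 0 ≤ L) {A : Finset ℂ}
    (hA : ∀ p ∈ A, ∀ q ∈ A, p ≠ q → d ≤ ‖p - q‖)
    (hbox : ∀ p ∈ A, p.re ∈ Set.Icc 0 L ∧ p.im ∈ Set.Icc 0 L) :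
    (A.card : ℝ) * (√3 / 2 * d ^ 2) ≤ (L + 2 * d) ^ 2 := by
  have h3 : 0 < √3 := by positivity
  have h31 : 1 ≤ √3 := Real.one_le_sqrt.2 (by norm_num)
  set ρ := d / √3 with hρd
  have hρ : 0 < ρ := by positivity
  have hρle : ρ ≤ d := div_le_self hd.le h31
  have hdρ : √3 * ρ = d := by rw [hρd]; field_simp
  have hvol : 3 * √3 / 2 * ρ ^ 2 = √3 / 2 * d ^ 2 := by
    rw [← hdρ, mul_pow, Real.sq_sqrt (by norm_num)]; ring
  have hcell := fun p hp => le_volume_truncatedCell hρ (A := A) (by rwa [hdρ]) (p := p) hp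
  -- Cells reach at most `ρ ≤ d` beyond the square.
  set B := Set.Icc (-d) (L + d) ×ˢ Set.Icc (-d) (L + d) with hB
  have hBm : MeasurableSet B := measurableSet_Icc.prod measurableSet_Icc
  have hBv : volume B = ENNReal.ofReal ((L + 2 * d) ^ 2) := by
    rw [hB, Measure.volume_eq_prod, Measure.prod_prod, Real.volume_Icc,
      ← ENNReal.ofReal_mul (by linarith)]
    congr 1; ring
  have hsub : ⋃ p ∈ A, truncatedCell ρ A p ⊆ Complex.measurableEquivRealProd ⁻¹' B := by
    refine Set.iUnion₂_subset fun p hp x hx => ?_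
    obtain ⟨⟨h1, h2⟩, h3, h4⟩ := hbox p hp
    have h5 := abs_le.1 ((Complex.abs_re_le_norm (x - p)).trans (hx.1.le.trans hρle))
    have h6 := abs_le.1 ((Complex.abs_im_le_norm (x - p)).trans (hx.1.le.trans hρle))
    simp only [Complex.sub_re, Complex.sub_im] at h5 h6
    refine ⟨⟨?_, ?_⟩, ?_, ?_⟩ <;> simp only [Complex.measurableEquivRealProd_apply] <;> linarith
  have h := measure_mono (μ := volume) hsub
  rw [Complex.volume_preserving_equiv_real_prod.measure_preimage hBm.nullMeasurableSet, hBv,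
    measure_biUnion_finset (fun p hp q hq hpq => disjoint_truncatedCell ρ hp hq hpq)
      (fun p _ => (isOpen_truncatedCell ρ A p).measurableSet)] at h
  have h' := (Finset.card_nsmul_le_sum A _ _ hcell).trans h
  rw [hvol, nsmul_eq_mul, ← ENNReal.ofReal_natCast, ← ENNReal.ofReal_mul (by positivity),
    ENNReal.ofReal_le_ofReal_iff (by positivity)] at h'
  exact h'

/-! ### Euclidean distance against hop distance -/

/-- A grid node as a point of the complex plane. -/
def gridPoint (u : ℤ × ℤ) : ℂ := ⟨u.1, u.2⟩

theorem gridPoint_injective : Function.Injective gridPoint := by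
  rintro ⟨a, b⟩ ⟨a', b'⟩ h
  simpa [gridPoint] using h

theorem gridDist_eq_norm (u v : ℤ × ℤ) : gridDist u v = ‖gridPoint u - gridPoint v‖ := by
  rw [gridDist, Real.sqrt_eq_iff_eq_sq (by positivity) (norm_nonneg _),
    Complex.sq_norm_eq_re_im]
  simp [gridPoint]

theorem gridDist_le_of_walk {R : ℝ} {u v : ℤ × ℤ} (p : (gridGraph R).Walk u v) :
    gridDist u v ≤ p.length * R := by
  induction p with
  | nil => simp [gridDist_eq_norm]
  | @cons a b c h p ih =>
    have h1 := h.2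
    rw [gridDist_eq_norm] at ih h1 ⊢
    rw [SimpleGraph.Walk.length_cons]
    push_cast
    linarith [norm_sub_le_norm_sub_add_norm_sub (gridPoint a) (gridPoint b)
      (gridPoint c)]

theorem gridDist_le_of_isHopNeighbour {R : ℝ} {k : ℕ} {u v : ℤ × ℤ}
    (h : IsHopNeighbour (gridGraph R) k u v) : gridDist u v ≤ k * R := by
  -- Nonzero distance excludes the default value for unreachable pairs, so a shortest walk exists.
  have hne : (gridGraph R).dist u v ≠ 0 := by have := h.1; have := h.2; omega
  obtain ⟨p, hp⟩ := (SimpleGraph.Reachable.of_dist_ne_zero hne).exists_walk_length_eq_dist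
  rw [← h.2, ← hp]
  exact gridDist_le_of_walk p

theorem SimpleGraph.exists_walk_length_le_of_chain {V : Type*} (G : SimpleGraph V) (f : ℕ → V)
    (n : ℕ) (hf : ∀ i < n, f i = f (i + 1) ∨ G.Adj (f i) (f (i + 1))) :
    ∃ p : G.Walk (f 0) (f n), p.length ≤ n := by
  induction n with
  | zero => exact ⟨.nil, le_rfl⟩
  | succ n ih =>
    obtain ⟨p, hp⟩ := ih fun i hi => hf i (by omega)
    rcases hf n (by omega) with h | h
    · exact ⟨p.copy rfl h, by rw [SimpleGraph.Walk.length_copy]; omega⟩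
    · exact ⟨p.concat h, by rw [SimpleGraph.Walk.length_concat]; omega⟩

theorem norm_gridPoint_round_sub_le (z : ℂ) :
    ‖gridPoint (round z.re, round z.im) - z‖ ≤ 1 := by
  refine (Complex.norm_le_abs_re_add_abs_im _).trans ?_
  have h1 := abs_sub_round z.re
  have h2 := abs_sub_round z.im
  rw [abs_sub_comm] at h1 h2
  simp only [gridPoint, Complex.sub_re, Complex.sub_im]
  linarith

/-- Split the segment into `h` equal parts and round. Steps have length at most `R - 2`, and
rounding moves each endpoint by at most `1`. Consecutive rounded points may coincide, hence chains
with repetitions. -/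
theorem exists_isHopNeighbour_of_gridDist_le {R : ℝ} {h : ℕ} (hh : 1 ≤ h) {u v : ℤ × ℤ}
    (huv : u ≠ v) (hd : gridDist u v ≤ h * (R - 2)) :
    ∃ k ≤ h, IsHopNeighbour (gridGraph R) k u v := by
  have hh0 : (0 : ℝ) < h := by exact_mod_cast hh
  set z : ℕ → ℂ := fun i => gridPoint u + (i / h : ℝ) * (gridPoint v - gridPoint u) with hz
  set f : ℕ → ℤ × ℤ := fun i => (round (z i).re, round (z i).im) with hf
  have hround : ∀ w : ℤ × ℤ, (round (gridPoint w).re, round (gridPoint w).im) = w := fun w => by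
    simp [gridPoint]
  have hf0 : f 0 = u := by simp [hf, hz, hround]
  have hfh : f h = v := by simp [hf, hz, hround, div_self hh0.ne']
  have hstep : ∀ i, gridDist (f i) (f (i + 1)) ≤ R := by
    intro i
    have h1 := norm_gridPoint_round_sub_le (z i)
    have h2 := norm_gridPoint_round_sub_le (z (i + 1))
    have h3 : ‖z i - z (i + 1)‖ ≤ R - 2 := by
      have : z i - z (i + 1) = ((1 / h : ℝ) : ℂ) * (gridPoint u - gridPoint v) := by
        simp only [hz]; push_cast; ring
      rw [this, norm_mul, Complex.norm_real, Real.norm_of_nonneg (by positivity),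
        ← gridDist_eq_norm, one_div_mul_eq_div, div_le_iff₀ hh0]
      linarith
    rw [gridDist_eq_norm]
    rw [norm_sub_rev] at h2
    have h4 := norm_sub_le_norm_sub_add_norm_sub (gridPoint (f i)) (z i) (gridPoint (f (i + 1)))
    have h5 := norm_sub_le_norm_sub_add_norm_sub (z i) (z (i + 1)) (gridPoint (f (i + 1)))
    linarith
  obtain ⟨p, hp⟩ := (gridGraph R).exists_walk_length_le_of_chain f h fun i _ => by
    by_cases h : f i = f (i + 1)
    · exact Or.inl h
    · exact Or.inr ⟨h, hstep i⟩
  rw [← hf0, ← hfh] at huv ⊢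
  exact ⟨_, (SimpleGraph.dist_le p).trans hp, p.reachable.pos_dist_of_ne huv, rfl⟩

/-! ### Lower bound on the number of colours -/

theorem mul_sq_le_mul_sq_of_isValidHopColouring {R : ℝ} {h n : ℕ} (hh : 1 ≤ h) (hR : 2 < R)
    {c : ℤ × ℤ → ℕ} (hc : IsValidHopColouring (gridGraph R) h c)
    (hn : (Set.range c).encard = (n : ℕ∞)) (N : ℕ) :
    (N : ℝ) ^ 2 * (√3 / 2 * (h * (R - 2)) ^ 2) ≤ n * (N + 2 * (h * (R - 2))) ^ 2 := by
  have hh0 : (0 : ℝ) < h := by exact_mod_cast hh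
  have hd : 0 < h * (R - 2) := mul_pos hh0 (by linarith)
  have hfin : (Set.range c).Finite := Set.finite_of_encard_eq_coe hn
  set C := hfin.toFinset with hC
  have hCn : C.card = n := by
    rw [hfin.encard_eq_coe_toFinset_card] at hn
    exact_mod_cast hn
  set Q : Finset (ℤ × ℤ) := Finset.Ico (0 : ℤ) N ×ˢ Finset.Ico (0 : ℤ) N with hQ
  have hQN : Q.card = N ^ 2 := by simp [hQ, sq]
  have hsum : Q.card = ∑ b ∈ C, (Q.filter fun u => c u = b).card :=
    Finset.card_eq_sum_card_fiberwise fun u _ => by simp [hC]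
  have hclass : ∀ b ∈ C, ((Q.filter fun u => c u = b).card : ℝ) * (√3 / 2 * (h * (R - 2)) ^ 2) ≤
      (N + 2 * (h * (R - 2))) ^ 2 := by
    intro b _
    rw [← Finset.card_image_of_injective _ gridPoint_injective]
    refine card_mul_le_of_separated hd (Nat.cast_nonneg N) ?_ ?_
    · intro p hp q hq hpq
      obtain ⟨u, hu, rfl⟩ := Finset.mem_image.1 hp
      obtain ⟨v, hv, rfl⟩ := Finset.mem_image.1 hq
      rw [← gridDist_eq_norm]
      by_contra! hlt
      obtain ⟨k, hk, hkn⟩ :=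
        exists_isHopNeighbour_of_gridDist_le hh (fun h => hpq (by rw [h])) hlt.le
      exact hc u v k hk hkn ((Finset.mem_filter.1 hu).2.trans (Finset.mem_filter.1 hv).2.symm)
    · intro p hp
      obtain ⟨u, hu, rfl⟩ := Finset.mem_image.1 hp
      have h1 := (Finset.mem_filter.1 hu).1
      simp only [hQ, Finset.mem_product, Finset.mem_Ico] at h1
      obtain ⟨⟨h1, h2⟩, h3, h4⟩ := h1
      refine ⟨⟨?_, ?_⟩, ?_, ?_⟩ <;> simp only [gridPoint] <;> exact_mod_cast by omega
  have h1 := Finset.sum_le_sum hclass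
  rw [← Finset.sum_mul, ← Nat.cast_sum, ← hsum, hQN, Finset.sum_const, hCn, nsmul_eq_mul] at h1
  exact_mod_cast h1

/-- Divide the count in an `N × N` square by `N ^ 2` and let `N → ∞`; the boundary term disappears.
-/
theorem le_card_of_isValidHopColouring {R : ℝ} {h n : ℕ} (hh : 1 ≤ h) (hR : 2 < R)
    {c : ℤ × ℤ → ℕ} (hc : IsValidHopColouring (gridGraph R) h c)
    (hn : (Set.range c).encard = (n : ℕ∞)) : √3 / 2 * (h * (R - 2)) ^ 2 ≤ n := by
  set D := 2 * (h * (R - 2)) with hD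
  have hlim : Tendsto (fun N : ℕ => (n : ℝ) * (1 + D / N) ^ 2) atTop (nhds ((n : ℝ) * (1 + 0) ^ 2)) :=
    ((tendsto_const_nhds.add (tendsto_const_div_atTop_nhds_zero_nat D)).pow 2).const_mul _
  rw [add_zero, one_pow, mul_one] at hlim
  refine ge_of_tendsto hlim ?_
  filter_upwards [eventually_gt_atTop 0] with N hN
  have hN0 : (0 : ℝ) < N := by exact_mod_cast hN
  have h1 := mul_sq_le_mul_sq_of_isValidHopColouring hh hR hc hn N
  have h2 : (n : ℝ) * (N + D) ^ 2 = (N : ℝ) ^ 2 * (n * (1 + D / N) ^ 2) := by field_simp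
  rw [← hD, h2] at h1
  exact le_of_mul_le_mul_left h1 (by positivity)

/-! ### The lattice colouring and the upper bound -/

/-- The colouring whose classes are the cosets of the lattice spanned by `(2m, 0)` and `(m, b)`. -/
def latticeColouring (m b : ℕ) (u : ℤ × ℤ) : ℕ :=
  (u.2 % b * (2 * m) + (u.1 - m * (u.2 / b)) % (2 * m)).toNat

theorem latticeColouring_eq_iff {m b : ℕ} (hm : 0 < m) (hb : 0 < b) (u u' : ℤ × ℤ) :
    latticeColouring m b u' = latticeColouring m b u ↔
      ∃ s t : ℤ, u' = u + s • ((2 * m, 0) : ℤ × ℤ) + t • ((m, b) : ℤ × ℤ) := by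
  have hm' : (0 : ℤ) < 2 * m := by omega
  have hb' : (0 : ℤ) < b := by omega
  have hnn : ∀ w : ℤ × ℤ, 0 ≤ w.2 % b * (2 * m) + (w.1 - m * (w.2 / b)) % (2 * m) := fun w =>
    add_nonneg (mul_nonneg (Int.emod_nonneg _ hb'.ne') hm'.le) (Int.emod_nonneg _ hm'.ne')
  obtain ⟨x, y⟩ := u
  obtain ⟨x', y'⟩ := u'
  constructor
  · intro h
    have h1 : y' % b * (2 * m) + (x' - m * (y' / b)) % (2 * m) =
        y % b * (2 * m) + (x - m * (y / b)) % (2 * m) := by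
      have h2 := congrArg (Nat.cast : ℕ → ℤ) h
      rwa [latticeColouring, latticeColouring, Int.toNat_of_nonneg (hnn _),
        Int.toNat_of_nonneg (hnn _)] at h2
    -- A colour is a two-digit number with lower digit in base `2 * m`; reduction modulo `2 * m`
    -- recovers that digit.
    have h2 : (x' - m * (y' / b)) % (2 * m) = (x - m * (y / b)) % (2 * m) := by
      have h3 := congrArg (· % (2 * m : ℤ)) h1
      simpa [Int.add_emod] using h3
    have h3 : y' % b = y % b := by
      rw [h2] at h1
      exact mul_right_cancel₀ hm'.ne' (add_right_cancel h1)
    refine ⟨(x' - m * (y' / b)) / (2 * m) - (x - m * (y / b)) / (2 * m), y' / b - y / b, ?_⟩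
    have e1 := Int.mul_ediv_add_emod (x' - m * (y' / b)) (2 * m)
    have e2 := Int.mul_ediv_add_emod (x - m * (y / b)) (2 * m)
    have e3 := Int.mul_ediv_add_emod y' b
    have e4 := Int.mul_ediv_add_emod y b
    ext
    · simp only [Prod.fst_add, Prod.smul_fst, smul_eq_mul]
      linear_combination h2 - e1 + e2
    · simp only [Prod.snd_add, Prod.smul_snd, smul_eq_mul, mul_zero, add_zero]
      linear_combination h3 - e3 + e4
  · rintro ⟨s, t, h⟩
    simp only [Prod.smul_mk, smul_eq_mul, mul_zero, Prod.mk_add_mk, add_zero, Prod.mk.injEq] at h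
    obtain ⟨rfl, rfl⟩ := h
    simp only [latticeColouring]
    rw [Int.add_mul_emod_self_right, Int.add_mul_ediv_right _ _ hb'.ne',
      show x + s * (2 * m) + t * m - m * (y / b + t) = x - m * (y / b) + s * (2 * m) by ring,
      Int.add_mul_emod_self_right]

theorem encard_range_latticeColouring {m b : ℕ} (hm : 0 < m) (hb : 0 < b) :
    (Set.range (latticeColouring m b)).encard = (2 * m * b : ℕ) := by
  have : Set.range (latticeColouring m b) = (Finset.range (2 * m * b) : Set ℕ) := by
    ext n
    simp only [Set.mem_range, Finset.coe_range, Set.mem_Iio]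
    constructor
    · rintro ⟨u, rfl⟩
      have h1 := Int.emod_lt_of_pos u.2 (show (0 : ℤ) < b by omega)
      have h2 := Int.emod_lt_of_pos (u.1 - m * (u.2 / b)) (show (0 : ℤ) < 2 * m by omega)
      rw [latticeColouring, Int.toNat_lt' (by positivity)]
      push_cast
      nlinarith
    · intro hn
      refine ⟨((n % (2 * m) : ℕ), (n / (2 * m) : ℕ)), ?_⟩
      have h1 : n / (2 * m) < b := by
        rw [Nat.div_lt_iff_lt_mul (by positivity), mul_comm]; exact hn
      have h2 := Nat.div_add_mod' n (2 * m)
      have h3 : ((n / (2 * m) : ℕ) : ℤ) % b = (n / (2 * m) : ℕ) := by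
        exact_mod_cast Nat.mod_eq_of_lt h1
      have h4 : ((n / (2 * m) : ℕ) : ℤ) / b = 0 := by
        exact_mod_cast Nat.div_eq_of_lt h1
      have h5 : ((n % (2 * m) : ℕ) : ℤ) % (2 * m) = (n % (2 * m) : ℕ) := by
        exact_mod_cast Nat.mod_mod n (2 * m)
      simp only [latticeColouring]
      rw [h3, h4, mul_zero, sub_zero, h5]
      have h6 : ((n / (2 * m) : ℕ) : ℤ) * (2 * m) + (n % (2 * m) : ℕ) = (n : ℤ) := by
        exact_mod_cast h2
      rw [h6, Int.toNat_natCast]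
  rw [this, Set.encard_coe_eq_coe_finsetCard, Finset.card_range]

theorem isVectorColouring_latticeColouring {m b : ℕ} (hm : 0 < m) (hb : 0 < b) :
    IsVectorColouring (latticeColouring m b) :=
  ⟨(2 * m, 0), (m, b), by simp [AreIndependent, hm.ne', hb.ne'],
    latticeColouring_eq_iff hm hb⟩

/-- Since `b ^ 2 ≥ 3 * m ^ 2`, the vector with coefficients `s`, `t` has squared length at least `4
* m ^ 2 * (s ^ 2 + s * t + t ^ 2)`. The form is a positive integer off the origin, so nonzero
lattice vectors have length at least `2 * m > h * R`. -/
theorem isValidHopColouring_latticeColouring {R : ℝ} {h m b : ℕ} (hR : 0 ≤ R) (hm : 0 < m)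
    (hb : 0 < b) (hmR : h * R < 2 * m) (hmb : 3 * m ^ 2 ≤ b ^ 2) :
    IsValidHopColouring (gridGraph R) h (latticeColouring m b) := by
  intro u v k hk hkn heq
  obtain ⟨s, t, hst⟩ := (latticeColouring_eq_iff hm hb v u).1 heq
  have hdist : gridDist u v < 2 * m := by
    refine ((gridDist_le_of_isHopNeighbour hkn).trans ?_).trans_lt hmR
    gcongr
  have hne : u ≠ v := by
    rintro rfl
    have := hkn.1
    have := hkn.2
    rw [SimpleGraph.dist_self] at this
    omega
  have hst0 : 1 ≤ s ^ 2 + s * t + t ^ 2 := by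
    have h0 : s ≠ 0 ∨ t ≠ 0 := by
      by_contra! h0
      exact hne (by simpa [h0.1, h0.2] using hst)
    have h1 : 0 < 4 * (s ^ 2 + s * t + t ^ 2) := by
      rw [show 4 * (s ^ 2 + s * t + t ^ 2) = (2 * s + t) ^ 2 + 3 * t ^ 2 by ring]
      rcases eq_or_ne t 0 with rfl | ht
      · have hs : s ≠ 0 := by simpa using h0
        simp only [add_zero]
        positivity
      · positivity
    omega
  have h1 : u.1 - v.1 = 2 * m * s + m * t := by rw [hst]; simp; ring
  have h2 : u.2 - v.2 = b * t := by rw [hst]; simp; ring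
  rw [gridDist, h1, h2, Real.sqrt_lt' (by positivity)] at hdist
  have h3 : (2 * m * s + m * t) ^ 2 + (b * t) ^ 2 < (2 * m : ℤ) ^ 2 := by exact_mod_cast hdist
  have h4 : (3 * m ^ 2 : ℤ) ≤ b ^ 2 := by exact_mod_cast hmb
  have h5 := mul_le_mul_of_nonneg_right h4 (sq_nonneg t)
  have h6 := mul_le_mul_of_nonneg_left hst0 (by positivity : (0 : ℤ) ≤ 4 * m ^ 2)
  linarith

theorem exists_mem_colourCounts_isVectorColouring_le {h : ℕ} (hh : 1 ≤ h) {R : ℝ} (hR : 1 ≤ R) :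
    ∃ n ∈ colourCounts IsVectorColouring h R,
      (n : ℝ) ≤ √3 / 2 * h ^ 2 * R ^ 2 * (1 + 20 / R) := by
  have hh1 : (1 : ℝ) ≤ h := by exact_mod_cast hh
  have hx : 1 ≤ h * R := one_le_mul_of_one_le_of_one_le hh1 hR
  have h31 : 1 ≤ √3 := Real.one_le_sqrt.2 (by norm_num)
  set m := ⌊h * R / 2⌋₊ + 1 with hm
  set b := ⌈√3 * m⌉₊ with hb
  have hm0 : 0 < m := by omega
  have hm1 : h * R < 2 * m := by
    have := Nat.lt_floor_add_one (h * R / 2)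
    rw [hm]; push_cast; linarith
  have hm2 : (m : ℝ) ≤ h * R / 2 + 1 := by
    have := Nat.floor_le (show 0 ≤ h * R / 2 by positivity)
    rw [hm]; push_cast; linarith
  have hb1 : √3 * m ≤ b := Nat.le_ceil _
  have hb2 : (b : ℝ) ≤ √3 * m + 1 := (Nat.ceil_lt_add_one (by positivity)).le
  have hb0 : 0 < b := Nat.ceil_pos.2 (by positivity)
  have hmb : 3 * m ^ 2 ≤ b ^ 2 := by
    have : (3 * m ^ 2 : ℝ) ≤ b ^ 2 := by
      calc (3 * m ^ 2 : ℝ) = (√3 * m) ^ 2 := by rw [mul_pow, Real.sq_sqrt (by norm_num)]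
        _ ≤ b ^ 2 := by gcongr
    exact_mod_cast this
  refine ⟨2 * m * b, ⟨latticeColouring m b, isVectorColouring_latticeColouring hm0 hb0,
    isValidHopColouring_latticeColouring (by linarith) hm0 hb0 hm1 hmb,
    encard_range_latticeColouring hm0 hb0⟩, ?_⟩
  push_cast
  have hxR : h * R ≤ h ^ 2 * R := by nlinarith
  calc (2 * m * b : ℝ) ≤ 2 * (h * R / 2 + 1) * (√3 * (h * R / 2 + 1) + 1) := by
        gcongr
        exact hb2.trans (by gcongr)
    _ = √3 / 2 * (h * R) ^ 2 + (2 * √3 + 1) * (h * R) + 2 * √3 + 2 := by ring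
    -- As `h * R ≥ 1` and `√3 ≥ 1`, all lower-order terms fit in `10 * √3 * (h * R)`, the source of
    -- the constant `20`.
    _ ≤ √3 / 2 * (h * R) ^ 2 + 10 * √3 * (h * R) := by nlinarith
    _ ≤ √3 / 2 * (h * R) ^ 2 + 10 * √3 * (h ^ 2 * R) := by gcongr
    _ = _ := by field_simp; ring

/-! ### Asymptotics of the optimum -/

theorem isPeriodicColouring_of_isVectorColouring {c : ℤ × ℤ → ℕ} (hc : IsVectorColouring c) :
    IsPeriodicColouring c := by
  obtain ⟨v, w, hvw, h⟩ := hc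
  exact ⟨v, w, hvw, fun u => (h u _).2 ⟨1, 0, by simp⟩, fun u => (h u _).2 ⟨0, 1, by simp⟩⟩

/-- The upper bound is attained within vector colourings and the lower bound needs only validity, so
any class containing the vector colourings has the same asymptotics. -/
theorem optimalColours_asymptotics {P : (ℤ × ℤ → ℕ) → Prop}
    (hP : ∀ c, IsVectorColouring c → P c) {h : ℕ} (hh : 1 ≤ h) :
    (∀ R : ℝ, 1 ≤ R → IsLeast (colourCounts P h R) (optimalColours P h R)) ∧
      ∃ ε : ℝ → ℝ, ε =O[atTop] (fun R : ℝ => 1 / R) ∧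
        ∀ R : ℝ, 1 ≤ R → (optimalColours P h R : ℝ) =
          √3 / 2 * (h : ℝ) ^ 2 * R ^ 2 * (1 + ε R) := by
  have hh0 : (0 : ℝ) < h := by exact_mod_cast hh
  have hexists : ∀ R : ℝ, 1 ≤ R → ∃ n ∈ colourCounts P h R,
      (n : ℝ) ≤ √3 / 2 * h ^ 2 * R ^ 2 * (1 + 20 / R) := by
    intro R hR
    obtain ⟨n, ⟨c, hc, hc'⟩, hn⟩ := exists_mem_colourCounts_isVectorColouring_le hh hR
    exact ⟨n, ⟨c, hP c hc, hc'⟩, hn⟩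
  have hleast : ∀ R : ℝ, 1 ≤ R → IsLeast (colourCounts P h R) (optimalColours P h R) :=
    fun R hR => ⟨Nat.sInf_mem ((hexists R hR).imp fun _ h => h.1), fun _ hn => Nat.sInf_le hn⟩
  refine ⟨hleast, fun R => optimalColours P h R / (√3 / 2 * (h : ℝ) ^ 2 * R ^ 2) - 1, ?_, ?_⟩
  · refine IsBigO.of_bound 20 ?_
    filter_upwards [eventually_gt_atTop 2] with R hR
    have hR0 : 0 < R := by linarith
    obtain ⟨c, -, hc, hn⟩ := (hleast R (by linarith)).1
    have hlow := le_card_of_isValidHopColouring hh hR hc hn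
    obtain ⟨n, hn, hup⟩ := hexists R (by linarith)
    have hup' : (optimalColours P h R : ℝ) ≤ √3 / 2 * h ^ 2 * R ^ 2 * (1 + 20 / R) :=
      le_trans (by exact_mod_cast (hleast R (by linarith)).2 hn) hup
    rw [Real.norm_eq_abs, Real.norm_of_nonneg (by positivity), abs_le, neg_le_sub_iff_le_add,
      sub_le_iff_le_add, div_le_iff₀ (by positivity), ← sub_le_iff_le_add,
      le_div_iff₀ (by positivity)]
    constructor
    · refine le_trans ?_ hlow
      -- It remains that `R ^ 2 - 20 * R ≤ (R - 2) ^ 2`.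
      have h1 : (1 - 20 * (1 / R)) * (√3 / 2 * h ^ 2 * R ^ 2) =
          √3 / 2 * h ^ 2 * (R ^ 2 - 20 * R) := by field_simp
      rw [h1, mul_pow, ← mul_assoc]
      gcongr
      nlinarith
    · exact hup'.trans_eq (by ring)
  · intro R hR
    have hR0 : 0 < R := by linarith
    rw [add_sub_cancel, mul_div_cancel₀]
    positivity

theorem mainTheorem8 (h : ℕ) (hh : 1 ≤ h) :
    ((∀ R : ℝ, 1 ≤ R → IsLeast (colourCounts IsPeriodicColouring h R)
        (optimalColours IsPeriodicColouring h R)) ∧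
      ∃ ε : ℝ → ℝ, ε =O[atTop] (fun R : ℝ => 1 / R) ∧
        ∀ R : ℝ, 1 ≤ R → (optimalColours IsPeriodicColouring h R : ℝ) =
          Real.sqrt 3 / 2 * (h : ℝ) ^ 2 * R ^ 2 * (1 + ε R)) ∧
    ((∀ R : ℝ, 1 ≤ R → IsLeast (colourCounts IsVectorColouring h R)
        (optimalColours IsVectorColouring h R)) ∧
      ∃ ε : ℝ → ℝ, ε =O[atTop] (fun R : ℝ => 1 / R) ∧
        ∀ R : ℝ, 1 ≤ R → (optimalColours IsVectorColouring h R : ℝ) =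
          Real.sqrt 3 / 2 * (h : ℝ) ^ 2 * R ^ 2 * (1 + ε R)) :=
  ⟨optimalColours_asymptotics (fun _ => isPeriodicColouring_of_isVectorColouring) hh,
    optimalColours_asymptotics (fun _ => id) hh⟩
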